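/- **Definitions.** All compact spaces are Hausdorff. A *pseudoclopen* of a compact space $K$ is a pair $a=(a^-,a^+)$ with $a^-\subseteq K$ closed, $a^+\subseteq K$ open and $a^-\subseteq a^+$. Given a family of sets $\mathcal G$, a function $\phi$ from $\mathcal G$ to the pseudoclopens of $K$ is an *isomorphism* (of $\mathcal G$ onto the family $\phi[\mathcal G]$) if for all $n,m\ge 0$ and all distinct $a_1,\dots,a_n,b_1,\dots,b_m\in\mathcal G$ $$\bigcap_{i\le n}a_i\setminus\bigcup_{j\le m}b_j=\emptyset\ \Longrightarrow\ \bigcap_{i\le n}\phi(a_i)^+\setminus\bigcup_{j\le m}\phi(b_j)^-=\emptyset ,$$ $$\bigcap_{i\le n}\phi(a_i)^-\setminus\bigcup_{j\le m}\phi(b_j)^+=\emptyset\ \Longrightarrow\ \bigcap_{i\le n}a_i\setminus\bigcup_{j\le m}b_j=\emptyset ,$$ where an empty intersection denotes the whole space. A compact zero-dimensional space $L$ is a *Boolean image* of a compact space $K$ if some family of clopen subsets of $L$ that separates the points of $L$ is isomorphic to a family of pseudoclopens of $K$. A *tree* is a partially ordered set $T$ with a minimum element in which every set $\{t\in T: t<s\}$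 is well ordered. The *tree space* of $T$ is the compact zero-dimensional space $L\subseteq 2^T$ of all $x\in 2^T$ such that $\{t\in T:x_t=1\}$ is either an initial segment $\{t\in T:t<s\}$ for some $s\in T$, or a full branch (a maximal chain) of $T$. **Theorem.** Let $T$ be the tree of all subsets of $\mathbb Q$ that are well ordered by the usual order, ordered by end-extension ($t\le s$ if and only if $t$ is an initial segment of $s$), and let $L\subseteq 2^T$ be its tree space. Then 1. $L$ is a Boolean image of some path-connected compact space; 2. $L$ is not a Boolean image of any compact convex subset of a Hausdorff real topological vector space. -/

import Mathlib

universe u v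

/-! ### Pseudoclopens and Boolean images -/

/-- A pseudoclopen (regular pair) in a topological space `K`: a closed set `lower` (written `a⁻`)
contained in an open set `upper` (written `a⁺`). -/
structure Pseudoclopen (K : Type u) [TopologicalSpace K] where
  lower : Set K
  upper : Set K
  isClosed_lower : IsClosed lower
  isOpen_upper : IsOpen upper
  lower_subset_upper : lower ⊆ upper

/-- `φ` is an isomorphism from the family of sets `G` (subsets of `L`) onto the family
`Set.range φ` of pseudoclopens of `K`.  The finite sets `A` and `B` list the distinct members
`a₁, …, aₙ` and `b₁, …, bₘ` of `G`; an empty intersection is the whole space.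
Injectivity of `φ` follows from the second clause, see `IsPseudoclopenIso.injective`. -/
def IsPseudoclopenIso {L : Type u} {K : Type v} [TopologicalSpace K]
    (G : Set (Set L)) (φ : G → Pseudoclopen K) : Prop :=
  ∀ A B : Finset G, Disjoint A B →
    (((⋂ a ∈ A, (a : Set L)) \ ⋃ b ∈ B, (b : Set L)) = ∅ →
      ((⋂ a ∈ A, (φ a).upper) \ ⋃ b ∈ B, (φ b).lower) = ∅) ∧
    (((⋂ a ∈ A, (φ a).lower) \ ⋃ b ∈ B, (φ b).upper) = ∅ →
      ((⋂ a ∈ A, (a : Set L)) \ ⋃ b ∈ B, (b : Set L)) = ∅)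

theorem IsPseudoclopenIso.injective {L : Type u} {K : Type v} [TopologicalSpace K]
    {G : Set (Set L)} {φ : G → Pseudoclopen K} (h : IsPseudoclopenIso G φ) :
    Function.Injective φ := by
  have key : ∀ a b : G, a ≠ b → φ a = φ b → (a : Set L) ⊆ b := by
    intro a b hab e
    have h2 := (h {a} {b} (by simpa using hab)).2
    simp only [Finset.mem_singleton, Set.iInter_iInter_eq_left, Set.iUnion_iUnion_eq_left,
      Set.sdiff_eq_empty] at h2
    exact h2 (e ▸ (φ a).lower_subset_upper)
  intro a b e
  by_contra hab
  exact hab (Subtype.ext ((key a b hab e).antisymm (key b a (Ne.symm hab) e.symm)))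

/-- The compact zero-dimensional space `L` is a Boolean image of the compact space `K`: some family
of clopen subsets of `L` that separates the points of `L` is isomorphic to a family of
pseudoclopens of `K`.  (A compact Hausdorff space is zero-dimensional if and only if it is totally
disconnected.) -/
def IsBooleanImage (L : Type u) (K : Type v)
    [TopologicalSpace L] [CompactSpace L] [T2Space L] [TotallyDisconnectedSpace L]
    [TopologicalSpace K] [CompactSpace K] [T2Space K] : Prop :=
  ∃ G : Set (Set L), (∀ a ∈ G, IsClopen a) ∧
    (∀ x y : L, x ≠ y → ∃ a ∈ G, (x ∈ a ∧ y ∉ a) ∨ (x ∉ a ∧ y ∈ a)) ∧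
    ∃ φ : G → Pseudoclopen K, IsPseudoclopenIso G φ

/-! ### Trees and tree spaces -/

/-- A tree: a partially ordered set with a minimum element in which every set `{t | t < s}` is well
ordered. -/
class IsOrderTree (T : Type u) [PartialOrder T] : Prop where
  exists_root : ∃ r : T, ∀ t, r ≤ t
  isWellOrder_Iio : ∀ s : T, IsWellOrder (Set.Iio s) (· < ·)

/-- The family of all subsets of `T` which are initial segments `{t | t < s}` or full branches
(maximal chains). -/
def treeCompletion (T : Type u) [PartialOrder T] : Set (Set T) :=
  {A | (∃ s, A = Set.Iio s) ∨ IsMaxChain (· ≤ ·) A}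

/-- The tree space of `T`, as a subspace of `2^T`. -/
def treeSpace (T : Type u) [PartialOrder T] : Set (T → Bool) :=
  {x | {t | x t = true} ∈ treeCompletion T}

theorem mem_treeCompletion_iff {T : Type u} [PartialOrder T] [IsOrderTree T] (A : Set T) :
    A ∈ treeCompletion T ↔ IsChain (· ≤ ·) A ∧ IsLowerSet A := by
  have chain : ∀ s : T, IsChain (· ≤ ·) (Set.Iic s) := by
    intro s a ha b hb hab
    rcases eq_or_lt_of_le (show a ≤ s from ha) with rfl | ha'
    · exact Or.inr hb
    rcases eq_or_lt_of_le (show b ≤ s from hb) with rfl | hb'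
    · exact Or.inl ha
    have := IsOrderTree.isWellOrder_Iio s
    rcases trichotomous_of (fun x y : Set.Iio s => x < y) ⟨a, ha'⟩ ⟨b, hb'⟩ with h | h | h
    · exact Or.inl (le_of_lt h)
    · exact absurd (congrArg Subtype.val h) hab
    · exact Or.inr (le_of_lt h)
  constructor
  · rintro (⟨s, rfl⟩ | hA)
    · exact ⟨(chain s).mono Set.Iio_subset_Iic_self, isLowerSet_Iio s⟩
    · refine ⟨hA.1, ?_⟩
      intro a b hba ha
      have hins : IsChain (· ≤ ·) (insert b A) := by
        refine hA.1.insert ?_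
        intro c hc hbc
        rcases hA.1.total ha hc with h | h
        · exact Or.inl (hba.trans h)
        · exact chain a hba h hbc
      rw [hA.2 hins (Set.subset_insert b A)]
      exact Set.mem_insert b A
  · rintro ⟨hc, hl⟩
    by_cases hmax : IsMaxChain (· ≤ ·) A
    · exact Or.inr hmax
    left
    have : ∃ B, IsChain (· ≤ ·) B ∧ A ⊆ B ∧ A ≠ B := by
      by_contra hcon
      push Not at hcon
      exact hmax ⟨hc, fun B hB hAB => hcon B hB hAB⟩
    obtain ⟨B, hB, hAB, hne⟩ := this
    obtain ⟨u, huB, huA⟩ : ∃ u ∈ B, u ∉ A := by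
      by_contra hcon
      push Not at hcon
      exact hne (hAB.antisymm hcon)
    have hlt : ∀ a ∈ A, ∀ v, v ≤ u → v ∉ A → a < v := by
      intro a ha v hv hvA
      have hau : a ≤ u := by
        rcases hB.total (hAB ha) huB with h | h
        · exact h
        · exact absurd (hl h ha) huA
      rcases (chain u).total hau hv with h | h
      · exact lt_of_le_of_ne h (fun e => hvA (e ▸ ha))
      · exact absurd (hl h ha) hvA
    by_cases hex : ∃ v, v < u ∧ v ∉ A
    · have hw := (IsOrderTree.isWellOrder_Iio u).wf
      obtain ⟨v, hv, hmin⟩ := hw.has_min {v : Set.Iio u | (v : T) ∉ A}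
        (by obtain ⟨v, h1, h2⟩ := hex; exact ⟨⟨v, h1⟩, h2⟩)
      refine ⟨v, Set.Subset.antisymm (fun a ha => hlt a ha v (le_of_lt v.2) hv) ?_⟩
      intro a ha
      by_contra haA
      exact hmin ⟨a, lt_trans ha v.2⟩ haA ha
    · push Not at hex
      exact ⟨u, Set.Subset.antisymm (fun a ha => hlt a ha u le_rfl huA) hex⟩

theorem isClosed_treeSpace (T : Type u) [PartialOrder T] [IsOrderTree T] :
    IsClosed (treeSpace T) := by
  have h : treeSpace T =
      (⋂ (s : T) (t : T), {x | x s = true → x t = true → s ≤ t ∨ t ≤ s}) ∩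
      (⋂ (s : T) (t : T), {x | s ≤ t → x t = true → x s = true}) := by
    ext x
    simp only [treeSpace, Set.mem_ofPred_eq, mem_treeCompletion_iff, Set.mem_inter_iff,
      Set.mem_iInter]
    constructor
    · rintro ⟨hc, hl⟩
      exact ⟨fun s t hs ht => hc.total hs ht, fun s t hst ht => hl hst ht⟩
    · rintro ⟨hc, hl⟩
      exact ⟨fun s hs t ht _ => hc s t hs ht, fun t s hst ht => hl s t hst ht⟩
  have hcl : ∀ (s t : T) (P : Bool → Bool → Prop), IsClosed {x : T → Bool | P (x s) (x t)} := by
    intro s t P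
    have hc : Continuous fun x : T → Bool => (x s, x t) :=
      (continuous_apply s).prodMk (continuous_apply t)
    exact (isClosed_discrete {p : Bool × Bool | P p.1 p.2}).preimage hc
  rw [h]
  exact (isClosed_iInter fun s => isClosed_iInter fun t =>
      hcl s t (fun p q => p = true → q = true → s ≤ t ∨ t ≤ s)).inter
    (isClosed_iInter fun s => isClosed_iInter fun t =>
      hcl s t (fun p q => s ≤ t → q = true → p = true))

instance (T : Type u) [PartialOrder T] [IsOrderTree T] : CompactSpace (treeSpace T) :=
  isCompact_iff_compactSpace.mp (isClosed_treeSpace T).isCompact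

/-! ### The tree of well-ordered subsets of `ℚ` -/

/-- A subset of `ℚ` that is well ordered by the usual order. -/
@[ext] structure WellOrderedSubsetRat where
  carrier : Set ℚ
  isWF : carrier.IsWF

/-- End-extension: `t ≤ s` if `t` is an initial segment of `s`. -/
instance : PartialOrder WellOrderedSubsetRat where
  le t s := t.carrier ⊆ s.carrier ∧ ∀ p ∈ s.carrier, ∀ q ∈ t.carrier, p < q → p ∈ t.carrier
  le_refl t := ⟨Set.Subset.rfl, fun _ hp _ _ _ => hp⟩
  le_trans t s r hts hsr :=
    ⟨hts.1.trans hsr.1, fun p hp q hq hpq =>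
      hts.2 p (hsr.2 p hp q (hts.1 hq) hpq) q hq hpq⟩
  le_antisymm t s hts hst := WellOrderedSubsetRat.ext (hts.1.antisymm hst.1)

theorem WellOrderedSubsetRat.le_def {t s : WellOrderedSubsetRat} :
    t ≤ s ↔ t.carrier ⊆ s.carrier ∧
      ∀ p ∈ s.carrier, ∀ q ∈ t.carrier, p < q → p ∈ t.carrier := Iff.rfl

theorem WellOrderedSubsetRat.exists_eq_of_lt {t s : WellOrderedSubsetRat} (h : t < s) :
    ∃ q ∈ s.carrier, t.carrier = {p | p ∈ s.carrier ∧ p < q} := by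
  have hne : (s.carrier \ t.carrier).Nonempty := by
    rw [Set.sdiff_nonempty]
    intro hst
    exact h.ne (WellOrderedSubsetRat.ext (h.le.1.antisymm hst))
  have hwf : (s.carrier \ t.carrier).IsWF := s.isWF.mono Set.sdiff_subset
  refine ⟨hwf.min hne, (hwf.min_mem hne).1, Set.ext fun p => ⟨fun hp => ⟨h.le.1 hp, ?_⟩, ?_⟩⟩
  · by_contra hcon
    rcases eq_or_lt_of_le (not_lt.mp hcon) with e | e
    · exact (hwf.min_mem hne).2 (e ▸ hp)
    · exact (hwf.min_mem hne).2 (h.le.2 _ (hwf.min_mem hne).1 p hp e)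
  · rintro ⟨hps, hlt⟩
    by_contra hpt
    exact hwf.not_lt_min hne ⟨hps, hpt⟩ hlt

instance : IsOrderTree WellOrderedSubsetRat where
  exists_root := ⟨⟨∅, Set.isWF_empty⟩, fun t => ⟨Set.empty_subset _, fun _ _ _ hq => hq.elim⟩⟩
  isWellOrder_Iio s := by
    choose f hf hf' using fun t : Set.Iio s => WellOrderedSubsetRat.exists_eq_of_lt t.2
    have hle : ∀ a b : Set.Iio s, f a < f b → a < b := by
      intro a b hab
      have hmem : f a ∈ (b : WellOrderedSubsetRat).carrier := by
        rw [hf' b]; exact ⟨hf a, hab⟩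
      have hnot : f a ∉ (a : WellOrderedSubsetRat).carrier := by
        rw [hf' a]; exact fun h => lt_irrefl _ h.2
      have h1 : (a : WellOrderedSubsetRat) ≤ b := by
        rw [WellOrderedSubsetRat.le_def, hf' a, hf' b]
        exact ⟨fun p hp => ⟨hp.1, hp.2.trans hab⟩,
          fun p hp q hq hpq => ⟨hp.1, hpq.trans hq.2⟩⟩
      exact lt_of_le_of_ne h1 (fun e => hnot ((congrArg
        (fun c : Set.Iio s => (c : WellOrderedSubsetRat).carrier) e) ▸ hmem))
    have hinj : ∀ a b : Set.Iio s, f a = f b → a = b := by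
      intro a b e
      refine Subtype.ext (WellOrderedSubsetRat.ext ?_)
      rw [hf' a, hf' b, e]
    have hlt : ∀ a b : Set.Iio s, a < b → f a < f b := by
      intro a b hab
      rcases lt_trichotomy (f a) (f b) with h | h | h
      · exact h
      · exact absurd (hinj a b h) hab.ne
      · exact absurd (hle b a h) hab.asymm
    let g : Set.Iio s → s.carrier := fun t => ⟨f t, hf t⟩
    have hwf : WellFounded (fun a b : Set.Iio s => a < b) :=
      Subrelation.wf (fun {a b} hab => show (g a) < (g b) from hlt a b hab)
        (InvImage.wf g s.isWF)
    exact
      { wf := hwf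
        trichotomous := fun a b h1 h2 => by
          rcases lt_trichotomy (f a) (f b) with h | h | h
          · exact absurd (hle a b h) h1
          · exact hinj a b h
          · exact absurd (hle b a h) h2 }

/-! ### Trees -/

section Tree

variable {T : Type u} [PartialOrder T]

theorem le_total_of_le [IsOrderTree T] {s t u : T} (hs : s ≤ u) (ht : t ≤ u) :
    s ≤ t ∨ t ≤ s := by
  rcases eq_or_lt_of_le hs with rfl | hs'
  · exact Or.inr ht
  rcases eq_or_lt_of_le ht with rfl | ht'
  · exact Or.inl hs
  have h : Set.Iio u ∈ treeCompletion T := Or.inl ⟨u, rfl⟩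
  exact ((mem_treeCompletion_iff _).1 h).1.total hs' ht'

theorem treeSpace_le_total [IsOrderTree T] (x : treeSpace T) {s t : T}
    (hs : x.1 s = true) (ht : x.1 t = true) : s ≤ t ∨ t ≤ s :=
  ((mem_treeCompletion_iff _).1 x.2).1.total hs ht

theorem treeSpace_lower [IsOrderTree T] (x : treeSpace T) {s t : T}
    (hst : s ≤ t) (ht : x.1 t = true) : x.1 s = true :=
  ((mem_treeCompletion_iff _).1 x.2).2 hst ht

open Classical in
/-- The point of the tree space given by a set of nodes. -/
noncomputable def treeSpacePoint (A : Set T) (hA : A ∈ treeCompletion T) : treeSpace T :=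
  ⟨fun t => decide (t ∈ A), by simpa [treeSpace] using hA⟩

@[simp] theorem treeSpacePoint_apply (A : Set T) (hA : A ∈ treeCompletion T) (t : T) :
    (treeSpacePoint A hA).1 t = true ↔ t ∈ A := by
  simp [treeSpacePoint]

theorem Iic_mem_treeCompletion [IsOrderTree T] (t : T) : Set.Iic t ∈ treeCompletion T :=
  (mem_treeCompletion_iff _).2
    ⟨fun _ hs _ hu _ => le_total_of_le hs hu, isLowerSet_Iic t⟩

/-- The point `{s | s ≤ t}` of the tree space. -/
noncomputable def nodePoint [IsOrderTree T] (t : T) : treeSpace T :=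
  treeSpacePoint (Set.Iic t) (Iic_mem_treeCompletion t)

/-- The point `{s | s < t}` of the tree space. -/
noncomputable def preNodePoint (t : T) : treeSpace T :=
  treeSpacePoint (Set.Iio t) (Or.inl ⟨t, rfl⟩)

@[simp] theorem nodePoint_apply [IsOrderTree T] (t s : T) :
    (nodePoint t).1 s = true ↔ s ≤ t := by simp [nodePoint]

@[simp] theorem preNodePoint_apply (t s : T) :
    (preNodePoint t).1 s = true ↔ s < t :=
  treeSpacePoint_apply _ _ _

theorem treeSpace_ext {x y : treeSpace T} (h : ∀ t, x.1 t = true ↔ y.1 t = true) : x = y :=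
  Subtype.ext (funext fun t => Bool.eq_iff_iff.2 (h t))

/-- The basic clopen set of the tree space given by a node. -/
def nodeClopen (t : T) : Set (treeSpace T) := {x | x.1 t = true}

theorem isClopen_nodeClopen (t : T) : IsClopen (nodeClopen t) := by
  have hc : Continuous fun x : treeSpace T => x.1 t :=
    (continuous_apply t).comp continuous_subtype_val
  exact (isClopen_discrete {true}).preimage hc

/-! ### The connectification of a tree space -/

variable (T) in
/-- The tree space with its gaps filled by intervals. -/
def filledTreeSpace : Set (T → ℝ) :=
  {y | (∀ t, y t ∈ Set.Icc (0 : ℝ) 1) ∧ (∀ s t, s ≤ t ∨ t ≤ s ∨ y s = 0 ∨ y t = 0) ∧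
    ∀ s t, t < s → y s = 0 ∨ y t = 1}

theorem isCompact_filledTreeSpace : IsCompact (filledTreeSpace T) := by
  have hcl : IsClosed (filledTreeSpace T) := by
    have hz : ∀ (t : T) (c : ℝ), IsClosed {y : T → ℝ | y t = c} := fun t c =>
      isClosed_eq (continuous_apply t) continuous_const
    simp only [filledTreeSpace, Set.ofPred_and, Set.ofPred_forall]
    refine (isClosed_iInter fun t => isClosed_Icc.preimage (continuous_apply t)).inter
      ((isClosed_iInter fun s => isClosed_iInter fun t => ?_).inter
        (isClosed_iInter fun s => isClosed_iInter fun t => isClosed_iInter fun _ =>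
          (hz s 0).union (hz t 1)))
    exact isClosed_const.union (isClosed_const.union ((hz s 0).union (hz t 0)))
  exact (isCompact_univ_pi fun _ : T => isCompact_Icc).of_isClosed_subset hcl
    fun y hy t _ => hy.1 t

theorem zero_mem_filledTreeSpace : (0 : T → ℝ) ∈ filledTreeSpace T :=
  ⟨fun _ => by simp, fun _ _ => by simp, fun _ _ _ => by simp⟩

theorem joined_zero_filledTreeSpace (y : filledTreeSpace T) (F w : T → ℝ) (B : ℝ)
    (hF : ∀ t, 0 ≤ F t) (hw : ∀ t, 0 < w t) (hB : ∀ t, F t + w t ≤ B)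
    (h : ∀ s t, y.1 s ≠ 0 → t < s → F t + w t ≤ F s) :
    Joined ⟨0, zero_mem_filledTreeSpace⟩ y := by
  obtain ⟨y, hy⟩ := y
  have hmem : ∀ r : ℝ, (fun t => min (y t) (max 0 ((B * r - F t) / w t))) ∈
      filledTreeSpace T := by
    intro r
    refine ⟨fun t => ⟨le_min (hy.1 t).1 (le_max_left _ _), (min_le_left _ _).trans (hy.1 t).2⟩,
      fun s t => ?_, fun s t hts => ?_⟩
    · rcases hy.2.1 s t with h | h | h | h
      · exact Or.inl h
      · exact Or.inr (Or.inl h)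
      · exact Or.inr (Or.inr (Or.inl (by simp [h])))
      · exact Or.inr (Or.inr (Or.inr (by simp [h])))
    · by_cases hs : y s = 0
      · left; simp [hs]
      have ht : y t = 1 := (hy.2.2 s t hts).resolve_left hs
      rcases le_or_gt (B * r) (F s) with hr | hr
      · left
        have : (B * r - F s) / w s ≤ 0 := div_nonpos_of_nonpos_of_nonneg (by linarith) (hw s).le
        simp only [max_eq_left this]
        exact min_eq_right (hy.1 s).1
      · right
        have h1 : 1 ≤ (B * r - F t) / w t := by
          rw [le_div_iff₀ (hw t)]
          have := h s t hs hts
          linarith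
        simp only [ht]
        exact min_eq_left (h1.trans (le_max_right _ _))
  refine ⟨⟨⟨fun r : unitInterval => ⟨_, hmem r⟩, ?_⟩, ?_, ?_⟩⟩
  · refine Continuous.subtype_mk (continuous_pi fun t => ?_) _
    fun_prop
  · refine Subtype.ext (funext fun t => ?_)
    have : (B * 0 - F t) / w t ≤ 0 :=
      div_nonpos_of_nonpos_of_nonneg (by linarith [hF t]) (hw t).le
    simp only [Set.Icc.coe_zero, max_eq_left this]
    exact min_eq_right (hy.1 t).1
  · refine Subtype.ext (funext fun t => ?_)
    have h1 : 1 ≤ (B * 1 - F t) / w t := by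
      rw [le_div_iff₀ (hw t)]
      linarith [hB t]
    simp only [Set.Icc.coe_one]
    exact min_eq_left ((hy.1 t).2.trans (h1.trans (le_max_right _ _)))

instance : CompactSpace (filledTreeSpace T) :=
  isCompact_iff_compactSpace.mp isCompact_filledTreeSpace

theorem isBooleanImage_filledTreeSpace [IsOrderTree T] :
    IsBooleanImage (treeSpace T) (filledTreeSpace T) := by
  classical
  have hev : ∀ t : T, Continuous fun y : filledTreeSpace T => y.1 t := fun t =>
    (continuous_apply t).comp continuous_subtype_val
  refine ⟨Set.range nodeClopen, ?_, ?_, ?_⟩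
  · rintro _ ⟨t, rfl⟩
    exact isClopen_nodeClopen t
  · intro x y hxy
    by_contra! hcon
    refine hxy (treeSpace_ext fun t => ?_)
    have := hcon (nodeClopen t) ⟨t, rfl⟩
    simp only [nodeClopen, Set.mem_ofPred_eq] at this
    tauto
  choose τ hτ using fun a : Set.range (nodeClopen (T := T)) => a.2
  have hmem : ∀ (a : Set.range (nodeClopen (T := T))) (x : treeSpace T),
      x ∈ (a : Set (treeSpace T)) ↔ x.1 (τ a) = true := by
    intro a x
    rw [← hτ a]; rfl
  have hinj : ∀ a b, τ a = τ b → a = b := fun a b h => Subtype.ext (by rw [← hτ, ← hτ, h])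
  refine ⟨fun a => ⟨{y | y.1 (τ a) = 1}, {y | 0 < y.1 (τ a)},
    isClosed_eq (hev _) continuous_const, isOpen_lt continuous_const (hev _),
    fun y hy => by simp only [Set.mem_ofPred_eq] at hy ⊢; rw [hy]; exact one_pos⟩, ?_⟩
  intro A B hAB
  constructor
  · intro hL
    by_contra hne
    obtain ⟨y, hyA, hyB⟩ := Set.nonempty_iff_ne_empty.2 hne
    simp only [Set.mem_iInter, Set.mem_iUnion, Set.mem_ofPred_eq, not_exists] at hyA hyB
    have hC : {u | ∃ a ∈ A, u ≤ τ a} ∈ treeCompletion T := by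
      refine (mem_treeCompletion_iff _).2 ⟨?_, ?_⟩
      · rintro u ⟨a, ha, hu⟩ v ⟨b, hb, hv⟩ -
        rcases y.2.2.1 (τ a) (τ b) with h | h | h | h
        · exact le_total_of_le (hu.trans h) hv
        · exact le_total_of_le hu (hv.trans h)
        · exact absurd h (hyA a ha).ne'
        · exact absurd h (hyA b hb).ne'
      · rintro u v hvu ⟨a, ha, hu⟩
        exact ⟨a, ha, hvu.trans hu⟩
    refine (Set.eq_empty_iff_forall_notMem.1 hL) (treeSpacePoint _ hC) ⟨?_, ?_⟩
    · simp only [Set.mem_iInter]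
      intro a ha
      rw [hmem, treeSpacePoint_apply]
      exact ⟨a, ha, le_rfl⟩
    · simp only [Set.mem_iUnion, not_exists]
      intro b hb
      rw [hmem, treeSpacePoint_apply]
      rintro ⟨a, ha, hba⟩
      have hne' : τ b ≠ τ a := fun e =>
        Finset.disjoint_left.1 hAB ha (hinj b a e ▸ hb)
      rcases y.2.2.2 _ _ (lt_of_le_of_ne hba hne') with h | h
      · exact (hyA a ha).ne' h
      · exact hyB b hb h
  · intro hK
    by_contra hne
    obtain ⟨x, hxA, hxB⟩ := Set.nonempty_iff_ne_empty.2 hne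
    simp only [Set.mem_iInter, Set.mem_iUnion, not_exists, hmem] at hxA hxB
    have hy : (fun t => if x.1 t = true then (1 : ℝ) else 0) ∈ filledTreeSpace T := by
      refine ⟨fun t => by dsimp only; split_ifs <;> simp, fun s t => ?_, fun s t hts => ?_⟩
      · by_cases hs : x.1 s = true
        · by_cases ht : x.1 t = true
          · rcases treeSpace_le_total x hs ht with h | h
            · exact Or.inl h
            · exact Or.inr (Or.inl h)
          · simp [ht]
        · simp [hs]
      · by_cases hs : x.1 s = true
        · simp [treeSpace_lower x hts.le hs]
        · simp [hs]
    refine (Set.eq_empty_iff_forall_notMem.1 hK) ⟨_, hy⟩ ⟨?_, ?_⟩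
    · simp only [Set.mem_iInter, Set.mem_ofPred_eq]
      intro a ha
      simp [hxA a ha]
    · simp only [Set.mem_iUnion, Set.mem_ofPred_eq, not_exists]
      intro b hb
      simp [hxB b hb]

end Tree

/-! ### Well-ordered sets of rationals -/

namespace WellOrderedSubsetRat

open Classical in
/-- The least element of `u` outside its proper initial segment `t`. -/
noncomputable def firstNew (t u : WellOrderedSubsetRat) : ℚ :=
  if h : t < u then (exists_eq_of_lt h).choose else 0

variable {t u v : WellOrderedSubsetRat}

theorem firstNew_mem (h : t < u) : firstNew t u ∈ u.carrier := by
  rw [firstNew, dif_pos h]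
  exact (exists_eq_of_lt h).choose_spec.1

theorem mem_iff_lt_firstNew (h : t < u) {p : ℚ} :
    p ∈ t.carrier ↔ p ∈ u.carrier ∧ p < firstNew t u := by
  rw [firstNew, dif_pos h]
  exact Set.ext_iff.1 (exists_eq_of_lt h).choose_spec.2 p

theorem firstNew_notMem (h : t < u) : firstNew t u ∉ t.carrier := fun hm =>
  lt_irrefl _ ((mem_iff_lt_firstNew h).1 hm).2

theorem firstNew_eq_of_le (h : t < u) (huv : u ≤ v) : firstNew t u = firstNew t v := by
  have h' : t < v := h.trans_le huv
  rcases lt_trichotomy (firstNew t u) (firstNew t v) with hlt | heq | hlt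
  · exact absurd ((mem_iff_lt_firstNew h').2 ⟨huv.1 (firstNew_mem h), hlt⟩) (firstNew_notMem h)
  · exact heq
  · exact absurd ((mem_iff_lt_firstNew h).2
      ⟨huv.2 _ (firstNew_mem h') _ (firstNew_mem h) hlt, hlt⟩) (firstNew_notMem h')

theorem firstNew_lt (h : t < u) (h' : u < v) : firstNew t u < firstNew u v :=
  ((mem_iff_lt_firstNew h').1 (firstNew_mem h)).2

/-- A summable family of weights on the rationals. -/
noncomputable def weight (q : ℚ) : ℝ := (1 / 2 : ℝ) ^ Encodable.encode q

theorem weight_pos (q : ℚ) : 0 < weight q := by unfold weight; positivity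

theorem summable_weight : Summable weight :=
  summable_geometric_two.comp_injective Encodable.encode_injective

theorem exists_spaced (C : Set WellOrderedSubsetRat) (hC : IsChain (· ≤ ·) C) :
    ∃ (F w : WellOrderedSubsetRat → ℝ) (B : ℝ), (∀ t, 0 ≤ F t) ∧ (∀ t, 0 < w t) ∧
      (∀ t, F t + w t ≤ B) ∧ ∀ s ∈ C, ∀ t, t < s → F t + w t ≤ F s := by
  classical
  let F : WellOrderedSubsetRat → ℝ := fun t => ∑' q, t.carrier.indicator weight q
  have hsum : ∀ A : Set ℚ, Summable (A.indicator weight) := fun A => summable_weight.indicator A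
  let q : WellOrderedSubsetRat → ℚ := fun t =>
    if h : ∃ s ∈ C, t < s then firstNew t h.choose else 0
  have hle1 : ∀ q, weight q ≤ 1 := fun q => pow_le_one₀ (by norm_num) (by norm_num)
  have hF : ∀ t, F t ≤ ∑' q, weight q := fun t =>
    (hsum _).tsum_le_tsum (Set.indicator_le_self' fun _ _ => (weight_pos _).le) summable_weight
  refine ⟨F, fun t => weight (q t), ∑' q, weight q + 1, ?_, fun t => weight_pos _,
    fun t => add_le_add (hF t) (hle1 _), ?_⟩
  · exact fun t => tsum_nonneg fun _ => Set.indicator_nonneg (fun _ _ => (weight_pos _).le) _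
  · intro s hs t hts
    have hex : ∃ s ∈ C, t < s := ⟨s, hs, hts⟩
    have hq : q t = firstNew t s := by
      simp only [q, dif_pos hex]
      rcases hC.total hex.choose_spec.1 hs with h | h
      · exact firstNew_eq_of_le hex.choose_spec.2 h
      · exact (firstNew_eq_of_le hts h).symm
    have hsingle : ∑' p, Set.indicator {q t} weight p = weight (q t) := by
      rw [tsum_eq_single (q t)]
      · simp
      · intro p hp
        simp [hp]
    simp only [F]
    rw [← hsingle, ← (hsum _).tsum_add (hsum _)]
    refine ((hsum _).add (hsum _)).tsum_le_tsum (fun p => ?_) (hsum _)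
    by_cases hp : p = q t
    · have h1 : p ∉ t.carrier := by rw [hp, hq]; exact firstNew_notMem hts
      have h2 : p ∈ s.carrier := by rw [hp, hq]; exact firstNew_mem hts
      simp [h1, h2, hp.symm]
    · by_cases h1 : p ∈ t.carrier
      · simp [h1, hts.le.1 h1, hp]
      · simp [h1, hp, Set.indicator_nonneg (fun _ _ => (weight_pos _).le) _]

theorem pathConnectedSpace_filledTreeSpace :
    PathConnectedSpace (filledTreeSpace WellOrderedSubsetRat) := by
  have key : ∀ y : filledTreeSpace WellOrderedSubsetRat,
      Joined ⟨0, zero_mem_filledTreeSpace⟩ y := by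
    intro y
    have hC : IsChain (· ≤ ·) {t | y.1 t ≠ 0} := by
      intro s hs t ht _
      rcases y.2.2.1 s t with h | h | h | h
      · exact Or.inl h
      · exact Or.inr h
      · exact absurd h hs
      · exact absurd h ht
    obtain ⟨F, w, B, hF, hw, hB, h⟩ := exists_spaced _ hC
    exact joined_zero_filledTreeSpace y F w B hF hw hB fun s t hs => h s hs t
  exact ⟨⟨⟨0, zero_mem_filledTreeSpace⟩⟩, fun x y => (key x).symm.trans (key y)⟩

end WellOrderedSubsetRat

/-! ### Special subsets of a tree -/

section Special

variable {T : Type u} [PartialOrder T]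

/-- A subset of a partial order is special if it is a countable union of antichains. -/
def IsSpecial (S : Set T) : Prop :=
  ∃ c : T → ℕ, ∀ s ∈ S, ∀ t ∈ S, s < t → c s ≠ c t

theorem IsSpecial.of_coloring {S : Set T} {ι : Type*} [Countable ι] (c : T → ι)
    (hc : ∀ s ∈ S, ∀ t ∈ S, s < t → c s ≠ c t) : IsSpecial S := by
  obtain ⟨e, he⟩ := Countable.exists_injective_nat ι
  exact ⟨fun t => e (c t), fun s hs t ht hst h => hc s hs t ht hst (he h)⟩

theorem IsSpecial.of_fibers {S : Set T} {ι : Type*} [Countable ι] (g : T → ι)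
    (h : ∀ i, IsSpecial {t | t ∈ S ∧ g t = i}) : IsSpecial S := by
  choose c hc using h
  refine .of_coloring (fun t => (g t, c (g t) t)) fun s hs t ht hst he => ?_
  simp only [Prod.mk.injEq] at he
  refine hc (g s) s ⟨hs, rfl⟩ t ⟨ht, he.1.symm⟩ hst ?_
  rw [he.2, he.1]

theorem wellFounded_lt_of_isOrderTree [IsOrderTree T] :
    WellFounded (fun s t : T => s < t) := by
  refine ⟨fun t => ⟨_, fun s hst => ?_⟩⟩
  have hw := (IsOrderTree.isWellOrder_Iio t).wf
  suffices ∀ s : Set.Iio t, Acc (fun s t : T => s < t) s from this ⟨s, hst⟩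
  intro s
  induction s using hw.induction with
  | _ s ih => exact ⟨_, fun r hr => ih ⟨r, hr.trans s.2⟩ hr⟩

/-- The pressing down lemma for non-special sets. -/
theorem IsSpecial.of_regressive [IsOrderTree T] {P : Set T} (hP : IsSpecial Pᶜ) (f : T → T)
    (hf : ∀ t ∈ P, f t < t) (h : ∀ s, IsSpecial {t | t ∈ P ∧ f t = s}) :
    IsSpecial (Set.univ : Set T) := by
  classical
  obtain ⟨d, hd⟩ := hP
  choose c hc using h
  have hwf := wellFounded_lt_of_isOrderTree (T := T)
  let col : T → List ℕ := hwf.fix fun t ih =>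
    if ht : t ∈ P then c (f t) t :: ih (f t) (hf t ht) else [d t]
  have hcol : ∀ t, col t = if t ∈ P then c (f t) t :: col (f t) else [d t] := by
    intro t
    simp only [col]
    rw [hwf.fix_eq]
    split_ifs <;> rfl
  have hnil : ∀ t, col t ≠ [] := by
    intro t
    rw [hcol]
    split_ifs <;> simp
  have key : ∀ t s, (s ≤ t ∨ t ≤ s) → col s = col t → s = t := by
    intro t
    induction t using hwf.induction with
    | _ t ih =>
      intro s hst he
      rw [hcol s, hcol t] at he
      split_ifs at he with hs ht ht
      · simp only [List.cons.injEq] at he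
        have hff : f s = f t := by
          refine ih _ (hf t ht) _ ?_ he.2
          rcases hst with h | h
          · exact le_total_of_le ((hf s hs).le.trans h) (hf t ht).le
          · exact le_total_of_le (hf s hs).le ((hf t ht).le.trans h)
        by_contra hne
        rw [hff] at he
        rcases hst with h | h
        · exact hc (f t) s ⟨hs, hff⟩ t ⟨ht, rfl⟩ (lt_of_le_of_ne h hne) he.1
        · exact hc (f t) t ⟨ht, rfl⟩ s ⟨hs, hff⟩ (lt_of_le_of_ne h (Ne.symm hne)) he.1.symm
      · simp only [List.cons.injEq] at he
        exact absurd he.2 (hnil _)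
      · simp only [List.cons.injEq] at he
        exact absurd he.2.symm (hnil _)
      · simp only [List.cons.injEq, and_true] at he
        by_contra hne
        rcases hst with h | h
        · exact hd s hs t ht (lt_of_le_of_ne h hne) he
        · exact hd t ht s hs (lt_of_le_of_ne h (Ne.symm hne)) he.symm
  exact .of_coloring col fun s _ t _ hst he => hst.ne (key t s (Or.inl hst.le) he)

theorem exists_strictMono_of_not_isSpecial [IsOrderTree T] {S : Set T} (hS : ¬ IsSpecial S) :
    ∃ t : ℕ → T, StrictMono t ∧ ∀ n, t n ∈ S := by
  by_contra hcon
  refine hS ⟨fun t => {u | u ∈ S ∧ u < t}.ncard, fun s hs t ht hst => ?_⟩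
  have hfin : {u | u ∈ S ∧ u < t}.Finite := by
    by_contra hinf
    have e := Set.Infinite.natEmbedding _ hinf
    obtain ⟨g, hg | hg⟩ := exists_increasing_or_nonincreasing_subseq (fun s t : T => s < t)
      (fun n => (e n : T))
    · exact hcon ⟨fun n => e (g n), fun m n hmn => hg m n hmn, fun n => (e (g n)).2.1⟩
    · refine (RelEmbedding.wellFounded_iff_isEmpty.1
        (wellFounded_lt_of_isOrderTree (T := T))).false (RelEmbedding.natGT
          (fun n => (e (g n) : T)) fun n => ?_)
      have hne : (e (g n) : T) ≠ e (g (n + 1)) := fun h =>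
        (Nat.lt_succ_self n).ne (g.injective (e.injective (Subtype.ext h)))
      rcases le_total_of_le (e (g n)).2.2.le (e (g (n + 1))).2.2.le with h | h
      · exact absurd (lt_of_le_of_ne h hne) (hg n (n + 1) (Nat.lt_succ_self n))
      · exact lt_of_le_of_ne h hne.symm
  have hss : {u | u ∈ S ∧ u < s} ⊂ {u | u ∈ S ∧ u < t} :=
    ⟨fun u hu => ⟨hu.1, hu.2.trans hst⟩, fun h => lt_irrefl s (h ⟨hs, hst⟩).2⟩
  exact (Set.ncard_lt_ncard hss hfin).ne

/-- A special tree admits a strictly increasing map to the rationals. -/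
theorem IsSpecial.exists_strictMono_rat (h : IsSpecial (Set.univ : Set T)) :
    ∃ f : T → ℚ, StrictMono f := by
  classical
  obtain ⟨c, hc⟩ := h
  let g : T → ℕ → ℚ := fun t n => if ∃ s ≤ t, c s = n then (1 / 2) ^ n else 0
  have hg0 : ∀ t n, 0 ≤ g t n := fun t n => by simp only [g]; split_ifs <;> positivity
  have hgle : ∀ t n, g t n ≤ (1 / 2) ^ n := fun t n => by
    simp only [g]; split_ifs <;> first | exact le_rfl | positivity
  have hmono : ∀ s t, s ≤ t → ∀ n, g s n ≤ g t n := by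
    intro s t hst n
    by_cases h : ∃ r ≤ s, c r = n
    · have h' : ∃ r ≤ t, c r = n := by
        obtain ⟨r, hr, e⟩ := h
        exact ⟨r, hr.trans hst, e⟩
      simp [g, h, h']
    · simp only [g, if_neg h]
      exact hg0 t n
  have hself : ∀ t, g t (c t) = (1 / 2) ^ c t := fun t => if_pos ⟨t, le_rfl, rfl⟩
  have hnew : ∀ s t, s < t → g s (c t) = 0 := by
    intro s t hst
    refine if_neg ?_
    rintro ⟨r, hr, e⟩
    exact hc r trivial t trivial (hr.trans_lt hst) e
  refine ⟨fun t => ∑ n ∈ Finset.range (c t + 1), g t n, fun s t hst => ?_⟩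
  show ∑ n ∈ Finset.range (c s + 1), g s n < ∑ n ∈ Finset.range (c t + 1), g t n
  rcases lt_or_gt_of_ne (hc s trivial t trivial hst) with hlt | hlt
  · rw [Finset.sum_range_succ _ (c t), hself]
    have h1 : ∑ n ∈ Finset.range (c s + 1), g s n ≤ ∑ n ∈ Finset.range (c t), g t n :=
      (Finset.sum_le_sum fun n _ => hmono s t hst.le n).trans
        (Finset.sum_le_sum_of_subset_of_nonneg (Finset.range_mono hlt) fun n _ _ => hg0 t n)
    have : (0 : ℚ) < (1 / 2) ^ c t := by positivity
    linarith
  · have htail : ∀ m, ∑ n ∈ Finset.range (c t + 1 + m), g s n + (1 / 2) ^ (c t + m) ≤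
        ∑ n ∈ Finset.range (c t), g s n + (1 / 2) ^ c t := by
      intro m
      induction m with
      | zero => simp [Finset.sum_range_succ, hnew s t hst]
      | succ m ih =>
        rw [← add_assoc, Finset.sum_range_succ]
        have h1 := hgle s (c t + 1 + m)
        have h2 : (1 / 2 : ℚ) ^ (c t + m) = (1 / 2) ^ (c t + 1 + m) + (1 / 2) ^ (c t + (m + 1)) := by
          rw [show c t + 1 + m = c t + m + 1 by ring, show c t + (m + 1) = c t + m + 1 by ring,
            pow_succ]
          ring
        linarith
    obtain ⟨m, hm⟩ := Nat.exists_eq_add_of_le (show c t + 1 ≤ c s + 1 by omega)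
    rw [Finset.sum_range_succ _ (c t), hself, hm]
    have h1 := htail m
    have h2 : ∑ n ∈ Finset.range (c t), g s n ≤ ∑ n ∈ Finset.range (c t), g t n :=
      Finset.sum_le_sum fun n _ => hmono s t hst.le n
    have : (0 : ℚ) < (1 / 2) ^ (c t + m) := by positivity
    linarith

end Special

namespace WellOrderedSubsetRat

theorem exists_union_of_isChain (C : Set WellOrderedSubsetRat) (hC : IsChain (· ≤ ·) C) :
    ∃ U : WellOrderedSubsetRat, (∀ z ∈ C, z ≤ U) ∧ ∀ q ∈ U.carrier, ∃ z ∈ C, q ∈ z.carrier := by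
  have hdown : ∀ z ∈ C, ∀ z' ∈ C, ∀ p ∈ z'.carrier, ∀ q ∈ z.carrier, p < q → p ∈ z.carrier := by
    intro z hz z' hz' p hp q hq hpq
    rcases hC.total hz hz' with h | h
    · exact h.2 p hp q hq hpq
    · exact h.1 hp
  have hwf : {q | ∃ z ∈ C, q ∈ z.carrier}.IsWF := by
    rw [Set.isWF_iff_no_descending_seq]
    intro g hg hmem
    obtain ⟨z, hz, h0⟩ := hmem 0
    refine Set.isWF_iff_no_descending_seq.1 z.isWF g hg fun n => ?_
    rcases Nat.eq_zero_or_pos n with rfl | hn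
    · exact h0
    · obtain ⟨z', hz', hn'⟩ := hmem n
      exact hdown z hz z' hz' _ hn' _ h0 (hg hn)
  refine ⟨⟨_, hwf⟩, fun z hz => ⟨fun q hq => ⟨z, hz, hq⟩, ?_⟩, fun q hq => hq⟩
  rintro p ⟨z', hz', hp⟩ q hq hpq
  exact hdown z hz z' hz' p hp q hq hpq

theorem exists_lt_of_mem {t : WellOrderedSubsetRat} {p : ℚ} (hp : p ∈ t.carrier) :
    ∃ s < t, ∀ q, q ∈ s.carrier ↔ q ∈ t.carrier ∧ q < p := by
  refine ⟨⟨{q | q ∈ t.carrier ∧ q < p}, t.isWF.mono fun q hq => hq.1⟩,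
    lt_of_le_of_ne ⟨fun q hq => hq.1, fun q hq r hr hqr => ⟨hq, hqr.trans hr.2⟩⟩ ?_,
    fun q => Iff.rfl⟩
  intro e
  have h : p ∈ t.carrier ∧ p < p := (Set.ext_iff.1 (congrArg carrier e) p).2 hp
  exact lt_irrefl p h.2

/-- Kurepa's theorem. -/
theorem not_strictMono_rat (f : WellOrderedSubsetRat → ℚ) : ¬ StrictMono f := by
  intro hf
  obtain ⟨M, hM, hmax⟩ := zorn_le₀ {M : WellOrderedSubsetRat | ∀ t < M, firstNew t M = f t} (by
    intro C hCs hC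
    obtain ⟨U, hU, hmem⟩ := exists_union_of_isChain C hC
    refine ⟨U, fun t ht => ?_, hU⟩
    obtain ⟨z, hz, hqz⟩ := hmem _ (firstNew_mem ht)
    have htz : t < z := by
      refine lt_of_le_of_ne ⟨fun p hp => ?_, fun p hp q hq hpq => ?_⟩ ?_
      · have := (mem_iff_lt_firstNew ht).1 hp
        exact (hU z hz).2 p this.1 _ hqz this.2
      · exact ht.le.2 p ((hU z hz).1 hp) q hq hpq
      · rintro rfl
        exact firstNew_notMem ht hqz
    rw [← firstNew_eq_of_le htz (hU z hz)]
    exact hCs hz t htz)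
  have hlt : ∀ p ∈ M.carrier, p < f M := by
    intro p hp
    obtain ⟨s, hs, hmem⟩ := exists_lt_of_mem hp
    have hps : firstNew s M = p := by
      refine le_antisymm (not_lt.1 fun h => ?_) (not_lt.1 fun h => ?_)
      · exact lt_irrefl p ((hmem p).1 ((mem_iff_lt_firstNew hs).2 ⟨hp, h⟩)).2
      · exact firstNew_notMem hs ((hmem _).2 ⟨firstNew_mem hs, h⟩)
    rw [← hps, hM s hs]
    exact hf hs
  let N : WellOrderedSubsetRat := ⟨insert (f M) M.carrier, M.isWF.insert _⟩
  have hMN : M < N := by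
    refine lt_of_le_of_ne ⟨Set.subset_insert _ _, fun p hp q hq hpq => ?_⟩ ?_
    · rcases hp with rfl | hp
      · exact absurd (hlt q hq) hpq.asymm
      · exact hp
    · intro e
      have : f M ∈ M.carrier := by
        have h : f M ∈ N.carrier := Set.mem_insert _ _
        rwa [← e] at h
      exact lt_irrefl _ (hlt _ this)
  have hnew : firstNew M N = f M :=
    (firstNew_mem hMN).resolve_right (firstNew_notMem hMN)
  refine absurd (hmax (y := N) (fun t ht => ?_) hMN.le) hMN.not_ge
  rcases le_total_of_le ht.le hMN.le with h | h
  · rcases eq_or_lt_of_le h with rfl | h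
    · exact hnew
    · rw [← firstNew_eq_of_le h hMN.le]
      exact hM t h
  · rcases eq_or_lt_of_le h with rfl | h
    · exact hnew
    · have h1 := firstNew_lt h ht
      rw [firstNew_eq_of_le h ht.le, hnew] at h1
      rcases firstNew_mem ht with h2 | h2
      · exact absurd h2 h1.ne'
      · exact absurd (hlt _ h2) h1.asymm

theorem not_isSpecial_univ : ¬ IsSpecial (Set.univ : Set WellOrderedSubsetRat) := fun h =>
  let ⟨f, hf⟩ := h.exists_strictMono_rat
  not_strictMono_rat f hf

/-- The nonempty well-ordered sets without a maximum. -/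
def limitNodes : Set WellOrderedSubsetRat :=
  {t | t.carrier.Nonempty ∧ ∀ q ∈ t.carrier, ∃ p ∈ t.carrier, q < p}

theorem isSpecial_compl_limitNodes : IsSpecial limitNodesᶜ := by
  classical
  refine .of_coloring (fun t => if h : ∃ q, IsGreatest t.carrier q then some h.choose else none)
    fun s _ t ht hst he => ?_
  have hgr : ∃ q, IsGreatest t.carrier q := by
    by_contra hcon
    refine ht ⟨⟨_, firstNew_mem hst⟩, fun q hq => ?_⟩
    by_contra! h
    exact hcon ⟨q, hq, h⟩
  simp only [dif_pos hgr] at he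
  by_cases hs : ∃ q, IsGreatest s.carrier q
  · simp only [dif_pos hs, Option.some.injEq] at he
    have h1 := hs.choose_spec.1
    rw [he] at h1
    exact absurd ((mem_iff_lt_firstNew hst).1 h1).2
      (hgr.choose_spec.2 (firstNew_mem hst)).not_gt
  · simp [hs] at he

end WellOrderedSubsetRat

/-! ### Points of compact spaces and families of pseudoclopens -/

section Pseudoclopen

variable {K : Type v} [TopologicalSpace K]

theorem IsPseudoclopenIso.exists_mem_upper {L : Type u} {G : Set (Set L)}
    {φ : G → Pseudoclopen K} (hφ : IsPseudoclopenIso G φ) (S : Finset G) (ε : G → Prop) (y : K)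
    (hy : ∀ a ∈ S, (ε a → y ∈ (φ a).upper) ∧ (¬ ε a → y ∉ (φ a).lower)) :
    ∃ x : L, ∀ a ∈ S, x ∈ (a : Set L) ↔ ε a := by
  classical
  by_contra! hcon
  have h := (hφ (S.filter ε) (S.filter fun a => ¬ ε a)
    (Finset.disjoint_filter_filter_not S S ε)).1
  have h1 := h (by
    refine Set.eq_empty_iff_forall_notMem.2 fun x hx => ?_
    simp only [Set.mem_sdiff, Set.mem_iInter, Set.mem_iUnion, Finset.mem_filter, not_exists,
      and_imp] at hx
    obtain ⟨a, ha, h⟩ := hcon x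
    have h2 := hx.1 a ha
    have h3 := hx.2 a
    tauto)
  refine Set.eq_empty_iff_forall_notMem.1 h1 y ?_
  simp only [Set.mem_sdiff, Set.mem_iInter, Set.mem_iUnion, Finset.mem_filter, not_exists,
      and_imp]
  exact ⟨fun a ha he => (hy a ha).1 he, fun a ha he => (hy a ha).2 he⟩

theorem IsPseudoclopenIso.exists_lift [CompactSpace K] {L : Type u} {G : Set (Set L)}
    {φ : G → Pseudoclopen K} (hφ : IsPseudoclopenIso G φ) (x : L) :
    ∃ k : K, ∀ a : G, (x ∈ (a : Set L) → k ∈ (φ a).lower) ∧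
      (x ∉ (a : Set L) → k ∉ (φ a).upper) := by
  classical
  let D : G → Set K := fun a => if x ∈ (a : Set L) then (φ a).lower else (φ a).upperᶜ
  have hD : (⋂ a, D a).Nonempty := by
    refine CompactSpace.iInter_nonempty (fun a => ?_) fun S => ?_
    · simp only [D]
      split_ifs
      · exact (φ a).isClosed_lower
      · exact (φ a).isOpen_upper.isClosed_compl
    · by_contra hne
      have h := (hφ (S.filter fun a => x ∈ (a : Set L)) (S.filter fun a => ¬ x ∈ (a : Set L))
        (Finset.disjoint_filter_filter_not S S _)).2
      have h1 := h (by
        refine Set.eq_empty_iff_forall_notMem.2 fun k hk => hne ⟨k, ?_⟩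
        simp only [Set.mem_sdiff, Set.mem_iInter, Set.mem_iUnion, Finset.mem_filter, not_exists,
          and_imp] at hk ⊢
        intro a ha
        by_cases hx : x ∈ (a : Set L)
        · simpa [D, hx] using hk.1 a ha hx
        · simpa [D, hx] using hk.2 a ha hx)
      refine Set.eq_empty_iff_forall_notMem.1 h1 x ?_
      simp only [Set.mem_sdiff, Set.mem_iInter, Set.mem_iUnion, Finset.mem_filter, not_exists,
          and_imp]
      exact ⟨fun a _ h => h, fun a _ h => h⟩
  obtain ⟨k, hk⟩ := hD
  refine ⟨k, fun a => ?_⟩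
  have := Set.mem_iInter.1 hk a
  by_cases hx : x ∈ (a : Set L)
  · simpa [D, hx] using this
  · simpa [D, hx] using this

theorem Pseudoclopen.exists_mem_sdiff (p : Pseudoclopen K) {γ : unitInterval → K}
    (hγ : Continuous γ) (h1 : ∃ r, γ r ∈ p.lower) (h2 : ∃ r, γ r ∉ p.upper) :
    ∃ r, γ r ∈ p.upper \ p.lower := by
  have h := isPreconnected_univ (α := unitInterval) (γ ⁻¹' p.upper) (γ ⁻¹' p.lowerᶜ)
    (p.isOpen_upper.preimage hγ) (p.isClosed_lower.isOpen_compl.preimage hγ)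
    (fun r _ => by
      by_cases hr : γ r ∈ p.lower
      · exact Or.inl (p.lower_subset_upper hr)
      · exact Or.inr hr)
    (by
      obtain ⟨r, hr⟩ := h1
      exact ⟨r, trivial, p.lower_subset_upper hr⟩)
    (by
      obtain ⟨r, hr⟩ := h2
      exact ⟨r, trivial, fun h => hr (p.lower_subset_upper h)⟩)
  obtain ⟨r, -, hr⟩ := h
  exact ⟨r, hr⟩

theorem Pseudoclopen.exists_finset_crossing (p : Pseudoclopen K) {X : Type*} [TopologicalSpace X]
    {C : Set X} (hC : IsCompact C) {Ψ : X × unitInterval → K} (hΨ : Continuous Ψ)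
    (h : ∀ z ∈ C, ∃ r, Ψ (z, r) ∈ p.upper \ p.lower) :
    ∃ R : Finset ℕ, ∀ z ∈ C, ∃ n ∈ R,
      Ψ (z, TopologicalSpace.denseSeq unitInterval n) ∈ p.upper \ p.lower := by
  have hopen : IsOpen (p.upper \ p.lower) := p.isOpen_upper.sdiff p.isClosed_lower
  obtain ⟨R, hR⟩ := hC.elim_finite_subcover
    (fun n => {z | Ψ (z, TopologicalSpace.denseSeq unitInterval n) ∈ p.upper \ p.lower})
    (fun n => hopen.preimage (by fun_prop)) (by
      intro z hz
      have ho : IsOpen {r | Ψ (z, r) ∈ p.upper \ p.lower} := hopen.preimage (by fun_prop)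
      obtain ⟨_, hr, n, rfl⟩ :=
        (TopologicalSpace.denseRange_denseSeq unitInterval).inter_open_nonempty _ ho (h z hz)
      exact Set.mem_iUnion.2 ⟨n, hr⟩)
  refine ⟨R, fun z hz => ?_⟩
  obtain ⟨n, hn, h⟩ := Set.mem_iUnion₂.1 (hR hz)
  exact ⟨n, hn, h⟩

end Pseudoclopen

theorem isClopen_mem_iff {X : Type*} [TopologicalSpace X] {a : Set X} (ha : IsClopen a)
    (p : Prop) : IsClopen {x | x ∈ a ↔ p} := by
  by_cases hp : p
  · simpa [hp] using ha
  · have h : {x | x ∈ a ↔ p} = aᶜ := Set.ext fun x => iff_false_right hp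
    exact h ▸ ha.compl

theorem exists_finset_separating {X : Type*} [TopologicalSpace X] [CompactSpace X]
    {G : Set (Set X)} (hG : ∀ a ∈ G, IsClopen a)
    (hsep : ∀ x y : X, x ≠ y → ∃ a ∈ G, (x ∈ a ∧ y ∉ a) ∨ (x ∉ a ∧ y ∈ a))
    {x : X} {U : Set X} (hU : IsOpen U) (hx : x ∈ U) :
    ∃ S : Finset G, ∀ y, (∀ a ∈ S, y ∈ (a : Set X) ↔ x ∈ (a : Set X)) → y ∈ U := by
  obtain ⟨S, hS⟩ := hU.isClosed_compl.isCompact.elim_finite_subfamily_closed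
    (fun a : G => {y | y ∈ (a : Set X) ↔ x ∈ (a : Set X)})
    (fun a => (isClopen_mem_iff (hG a a.2) _).1) (by
      refine Set.eq_empty_iff_forall_notMem.2 fun y hy => ?_
      have hne : x ≠ y := fun e => hy.1 (e ▸ hx)
      obtain ⟨a, ha, h⟩ := hsep x y hne
      have := Set.mem_iInter.1 hy.2 ⟨a, ha⟩
      simp only [Set.mem_ofPred_eq] at this
      tauto)
  refine ⟨S, fun y hy => ?_⟩
  by_contra hyU
  exact Set.eq_empty_iff_forall_notMem.1 hS y ⟨hyU, Set.mem_iInter₂.2 hy⟩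

/-! ### Clopen sets of tree spaces -/

theorem exists_finset_mem_iff_nodePoint {T : Type u} [PartialOrder T] [IsOrderTree T]
    {a : Set (treeSpace T)} (ha : IsClopen a) (t : T) :
    ∃ F : Finset T, (∀ u ∈ F, t < u) ∧ ∀ x : treeSpace T, x.1 t = true →
      (∀ u ∈ F, ¬ x.1 u = true) → (x ∈ a ↔ nodePoint t ∈ a) := by
  classical
  have hU := isClopen_mem_iff ha (nodePoint t ∈ a)
  obtain ⟨F, hF⟩ := ((isClopen_nodeClopen t).1.inter
      hU.compl.1).isCompact.elim_finite_subfamily_closed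
    (fun u : Set.Ioi t => (nodeClopen (u : T))ᶜ) (fun u => (isClopen_nodeClopen _).compl.1) (by
      refine Set.eq_empty_iff_forall_notMem.2 fun x hx => hx.1.2 ?_
      have hxe : x = nodePoint t := by
        refine treeSpace_ext fun u => ?_
        rw [nodePoint_apply]
        refine ⟨fun hu => ?_, fun hu => treeSpace_lower x hu hx.1.1⟩
        by_contra hut
        have htu : t < u := lt_of_le_not_ge ((treeSpace_le_total x hu hx.1.1).resolve_left hut) hut
        exact Set.mem_iInter.1 hx.2 ⟨u, htu⟩ hu
      rw [hxe]
      exact Iff.rfl)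
  refine ⟨F.image Subtype.val, ?_, fun x hxt hx => ?_⟩
  · intro u hu
    obtain ⟨u, -, rfl⟩ := Finset.mem_image.1 hu
    exact u.2
  · by_contra hcon
    exact Set.eq_empty_iff_forall_notMem.1 hF x ⟨⟨hxt, hcon⟩, Set.mem_iInter₂.2 fun u hu =>
      hx u (Finset.mem_image_of_mem _ hu)⟩

namespace WellOrderedSubsetRat

theorem exists_finset_firstNew {a : Set (treeSpace WellOrderedSubsetRat)} (ha : IsClopen a)
    (t : WellOrderedSubsetRat) :
    ∃ Q : Finset ℚ, ∀ (x : treeSpace WellOrderedSubsetRat) (u : WellOrderedSubsetRat), t < u →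
      x.1 u = true → firstNew t u ∉ Q → (x ∈ a ↔ nodePoint t ∈ a) := by
  obtain ⟨F, hF, h⟩ := exists_finset_mem_iff_nodePoint ha t
  refine ⟨F.image (firstNew t), fun x u htu hxu hQ => h x (treeSpace_lower x htu.le hxu) ?_⟩
  intro w hw hxw
  refine hQ (Finset.mem_image.2 ⟨w, hw, ?_⟩)
  rcases treeSpace_le_total x hxu hxw with h | h
  · exact (firstNew_eq_of_le htu h).symm
  · exact firstNew_eq_of_le (hF w hw) h

theorem eq_preNodePoint {t : WellOrderedSubsetRat} (ht : t ∈ limitNodes)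
    {x : treeSpace WellOrderedSubsetRat} (hx : ∀ s < t, x.1 s = true) (hxt : ¬ x.1 t = true) :
    x = preNodePoint t := by
  refine treeSpace_ext fun u => ?_
  rw [preNodePoint_apply]
  refine ⟨fun hu => ?_, hx u⟩
  by_contra hut
  have hle : ∀ s < t, s ≤ u := fun s hs =>
    (treeSpace_le_total x (hx s hs) hu).resolve_right fun h => hut (h.trans_lt hs)
  have hmem : ∀ q ∈ t.carrier, ∃ s < t, q ∈ s.carrier := by
    intro q hq
    obtain ⟨p, hp, hqp⟩ := ht.2 q hq
    obtain ⟨s, hs, h⟩ := exists_lt_of_mem hp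
    exact ⟨s, hs, (h q).2 ⟨hq, hqp⟩⟩
  refine hxt (treeSpace_lower x ⟨fun q hq => ?_, fun p hp q hq hpq => ?_⟩ hu)
  · obtain ⟨s, hs, h⟩ := hmem q hq
    exact (hle s hs).1 h
  · obtain ⟨s, hs, h⟩ := hmem q hq
    exact hs.le.1 ((hle s hs).2 p hp q h hpq)

theorem exists_lt_mem_iff_preNodePoint {a : Set (treeSpace WellOrderedSubsetRat)}
    (ha : IsClopen a) {t : WellOrderedSubsetRat} (ht : t ∈ limitNodes) :
    ∃ s < t, ∀ x : treeSpace WellOrderedSubsetRat, x.1 s = true → ¬ x.1 t = true →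
      (x ∈ a ↔ preNodePoint t ∈ a) := by
  have hU := isClopen_mem_iff ha (preNodePoint t ∈ a)
  have hne : Nonempty (Set.Iio t) := by
    obtain ⟨p, hp⟩ := ht.1
    obtain ⟨s, hs, -⟩ := exists_lt_of_mem hp
    exact ⟨⟨s, hs⟩⟩
  obtain ⟨s, hs⟩ := ((isClopen_nodeClopen t).compl.1.inter
      hU.compl.1).isCompact.elim_directed_family_closed
    (fun s : Set.Iio t => nodeClopen (s : WellOrderedSubsetRat))
    (fun s => (isClopen_nodeClopen _).1) (by
      refine Set.eq_empty_iff_forall_notMem.2 fun x hx => hx.1.2 ?_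
      rw [eq_preNodePoint ht (fun s hs => Set.mem_iInter.1 hx.2 ⟨s, hs⟩) hx.1.1]
      exact Iff.rfl) (by
      intro r s
      rcases le_total_of_le (Set.mem_Iio.1 r.2).le (Set.mem_Iio.1 s.2).le with h | h
      · exact ⟨s, fun x hx => treeSpace_lower x h hx, fun x hx => hx⟩
      · exact ⟨r, fun x hx => hx, fun x hx => treeSpace_lower x h hx⟩)
  refine ⟨s, s.2, fun x hxs hxt => ?_⟩
  by_contra hcon
  exact Set.eq_empty_iff_forall_notMem.1 hs x ⟨⟨hxt, hcon⟩, hxs⟩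

/-! ### Equiconnected compact spaces -/

theorem not_isBooleanImage_of_equiconnected {K : Type v} [TopologicalSpace K] [CompactSpace K]
    [T2Space K] (Φ : (K × K) × unitInterval → K) (hΦ : Continuous Φ)
    (h0 : ∀ x y, Φ ((x, y), 0) = x) (h1 : ∀ x y, Φ ((x, y), 1) = y)
    (hdiag : ∀ x r, Φ ((x, x), r) = x) :
    ¬ IsBooleanImage (treeSpace WellOrderedSubsetRat) K := by
  classical
  rintro ⟨G, hG, hsep, φ, hφ⟩
  choose k hk using hφ.exists_lift
  have hex : ∀ t : WellOrderedSubsetRat, ∃ a : G,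
      ¬ (preNodePoint t ∈ (a : Set (treeSpace WellOrderedSubsetRat)) ↔ nodePoint t ∈ a.1) := by
    intro t
    have hne : preNodePoint t ≠ nodePoint t := by
      intro e
      have h : (nodePoint t).1 t = true := (nodePoint_apply t t).2 le_rfl
      rw [← e] at h
      exact lt_irrefl t ((preNodePoint_apply t t).1 h)
    obtain ⟨a, ha, h⟩ := hsep _ _ hne
    exact ⟨⟨a, ha⟩, by dsimp only; tauto⟩
  choose a ha using hex
  have hcross : ∀ p : Pseudoclopen K, ∃ R : Finset ℕ, ∀ x y,
      (x ∈ p.lower ∧ y ∉ p.upper) ∨ (x ∉ p.upper ∧ y ∈ p.lower) → ∃ n ∈ R,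
        Φ ((x, y), TopologicalSpace.denseSeq unitInterval n) ∈ p.upper \ p.lower := by
    intro p
    have hC : IsClosed ((p.lower ×ˢ p.upperᶜ) ∪ (p.upperᶜ ×ˢ p.lower)) :=
      (p.isClosed_lower.prod p.isOpen_upper.isClosed_compl).union
        (p.isOpen_upper.isClosed_compl.prod p.isClosed_lower)
    obtain ⟨R, hR⟩ := p.exists_finset_crossing hC.isCompact hΦ (by
      rintro ⟨x, y⟩ hxy
      refine p.exists_mem_sdiff (γ := fun r => Φ ((x, y), r)) (by fun_prop) ?_ ?_
      · rcases hxy with h | h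
        · exact ⟨0, by rw [h0]; exact h.1⟩
        · exact ⟨1, by rw [h1]; exact h.2⟩
      · rcases hxy with h | h
        · exact ⟨1, by rw [h1]; exact h.2⟩
        · exact ⟨0, by rw [h0]; exact h.1⟩)
    exact ⟨R, fun x y h => hR (x, y) h⟩
  choose R hR using fun t => hcross (φ (a t))
  choose Q hQ using fun t => exists_finset_firstNew (hG _ (a t).2) t
  have hpre : ∀ t : WellOrderedSubsetRat, ∃ s, t ∈ limitNodes → s < t ∧
      ∀ x : treeSpace WellOrderedSubsetRat, x.1 s = true → ¬ x.1 t = true →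
        (x ∈ (a t).1 ↔ preNodePoint t ∈ (a t).1) := by
    intro t
    by_cases ht : t ∈ limitNodes
    · obtain ⟨s, hs⟩ := exists_lt_mem_iff_preNodePoint (hG _ (a t).2) ht
      exact ⟨s, fun _ => hs⟩
    · exact ⟨t, fun h => absurd h ht⟩
  choose f hf using hpre
  refine not_isSpecial_univ (isSpecial_compl_limitNodes.of_regressive f (fun t ht => (hf t ht).1)
    fun s₀ => .of_fibers (fun t => (R t, Q t)) fun RQ => ?_)
  obtain ⟨R₀, Q₀⟩ := RQ
  by_contra hns
  obtain ⟨t, ht, htS⟩ := exists_strictMono_of_not_isSpecial hns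
  simp only [Set.mem_ofPred_eq, Prod.mk.injEq] at htS
  have hs₀ : ∀ i, s₀ < t i := fun i => (htS i).1.2 ▸ (hf _ (htS i).1.1).1
  have hout : ∀ i (x : treeSpace WellOrderedSubsetRat), x.1 s₀ = true → ¬ x.1 (t i) = true →
      (x ∈ (a (t i)).1 ↔ preNodePoint (t i) ∈ (a (t i)).1) := fun i x hx =>
    (hf _ (htS i).1.1).2 x ((htS i).1.2.symm ▸ hx)
  have hgood : ∀ᶠ i in Filter.atTop, firstNew (t i) (t (i + 1)) ∉ Q₀ := by
    have hmono : StrictMono fun i => firstNew (t i) (t (i + 1)) :=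
      strictMono_nat_of_lt_succ fun i => firstNew_lt (ht (Nat.lt_succ_self _))
        (ht (Nat.lt_succ_self _))
    rw [← Nat.cofinite_eq_atTop]
    exact hmono.injective.tendsto_cofinite.eventually Q₀.finite_toSet.compl_mem_cofinite
  have hin : ∀ i j, firstNew (t i) (t (i + 1)) ∉ Q₀ → i < j →
      ∀ x : treeSpace WellOrderedSubsetRat, x.1 (t j) = true →
        (x ∈ (a (t i)).1 ↔ nodePoint (t i) ∈ (a (t i)).1) := by
    intro i j hi hij x hx
    refine hQ (t i) x (t j) (ht hij) hx ?_
    rwa [(htS i).2.2, ← firstNew_eq_of_le (ht (Nat.lt_succ_self i)) (ht.monotone hij)]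
  have hinj : ∀ i j, firstNew (t i) (t (i + 1)) ∉ Q₀ → i < j → a (t i) ≠ a (t j) := by
    intro i j hi hij he
    have hx : ∀ x : treeSpace WellOrderedSubsetRat, x.1 (t (i + 1)) = true →
        (x ∈ (a (t i)).1 ↔ nodePoint (t i) ∈ (a (t i)).1) := hin i (i + 1) hi (Nat.lt_succ_self i)
    have e1 := hin i j hi hij (nodePoint (t j)) ((nodePoint_apply _ _).2 le_rfl)
    have e2 := hout j (nodePoint (t i)) ((nodePoint_apply _ _).2 (hs₀ i).le)
      (fun h => (ht hij).not_ge ((nodePoint_apply _ _).1 h))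
    rw [he] at e1
    exact ha (t j) (e2.symm.trans e1.symm)
  obtain ⟨z, hz, hcl⟩ : ∃ z : treeSpace WellOrderedSubsetRat × K,
      (z.1.1 s₀ = true ∧ ∀ b : G, (z.1 ∈ b.1 → z.2 ∈ (φ b).lower) ∧
        (z.1 ∉ b.1 → z.2 ∉ (φ b).upper)) ∧
      MapClusterPt z Filter.atTop fun i => (nodePoint (t i), k (nodePoint (t i))) := by
    have hV : IsClosed {z : treeSpace WellOrderedSubsetRat × K | z.1.1 s₀ = true ∧
        ∀ b : G, (z.1 ∈ b.1 → z.2 ∈ (φ b).lower) ∧ (z.1 ∉ b.1 → z.2 ∉ (φ b).upper)} := by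
      have hS : IsClosed {z : treeSpace WellOrderedSubsetRat × K | z.1.1 s₀ = true} :=
        (isClopen_nodeClopen s₀).1.preimage continuous_fst
      have hb : ∀ b : G, IsClosed {z : treeSpace WellOrderedSubsetRat × K |
          (z.1 ∈ b.1 → z.2 ∈ (φ b).lower) ∧ (z.1 ∉ b.1 → z.2 ∉ (φ b).upper)} := by
        intro b
        simp only [imp_iff_not_or, not_not, Set.ofPred_and, Set.ofPred_or]
        exact (((hG _ b.2).compl.1.preimage continuous_fst).union
          ((φ b).isClosed_lower.preimage continuous_snd)).inter
          (((hG _ b.2).1.preimage continuous_fst).union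
            ((φ b).isOpen_upper.isClosed_compl.preimage continuous_snd))
      have hT := isClosed_iInter hb
      rw [← Set.ofPred_forall] at hT
      exact hS.inter hT
    exact hV.isCompact.exists_mapClusterPt (Filter.tendsto_principal.2 <| .of_forall fun i =>
      ⟨(nodePoint_apply _ _).2 (hs₀ i).le, hk _⟩)
  obtain ⟨x₀, k₀⟩ := z
  obtain ⟨hx₀, hk₀⟩ := hz
  obtain ⟨S, hS⟩ := exists_finset_separating hG hsep (isClopen_nodeClopen s₀).2 hx₀
  have hO : ∀ᶠ y in nhds k₀, ∀ b ∈ S, (x₀ ∈ b.1 → y ∈ (φ b).upper) ∧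
      (x₀ ∉ b.1 → y ∉ (φ b).lower) := by
    refine (Filter.eventually_all_finset S).2 fun b _ => ?_
    by_cases hb : x₀ ∈ b.1
    · filter_upwards [(φ b).isOpen_upper.mem_nhds
        ((φ b).lower_subset_upper ((hk₀ b).1 hb))] with y hy
      exact ⟨fun _ => hy, fun h => absurd hb h⟩
    · filter_upwards [(φ b).isClosed_lower.isOpen_compl.mem_nhds
        (fun h => (hk₀ b).2 hb ((φ b).lower_subset_upper h))] with y hy
      exact ⟨fun h => absurd h hb, fun _ => hy⟩
  have hΦO : ∀ᶠ p in nhds (k₀, k₀), ∀ n ∈ R₀, ∀ b ∈ S,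
      (x₀ ∈ b.1 → Φ (p, TopologicalSpace.denseSeq unitInterval n) ∈ (φ b).upper) ∧
      (x₀ ∉ b.1 → Φ (p, TopologicalSpace.denseSeq unitInterval n) ∉ (φ b).lower) := by
    refine (Filter.eventually_all_finset R₀).2 fun n _ => ?_
    have hc : Filter.Tendsto (fun p => Φ (p, TopologicalSpace.denseSeq unitInterval n))
        (nhds (k₀, k₀)) (nhds k₀) := by
      have h : Continuous fun p => Φ (p, TopologicalSpace.denseSeq unitInterval n) := by fun_prop
      simpa only [hdiag] using h.tendsto (k₀, k₀)
    exact hc.eventually hO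
  obtain ⟨W₁, hW₁, W₂, hW₂, hW⟩ := mem_nhds_prod_iff.1 hΦO
  have hnotS : ∀ᶠ i in Filter.atTop, ¬ (firstNew (t i) (t (i + 1)) ∉ Q₀ ∧ a (t i) ∈ S) := by
    rw [← Nat.cofinite_eq_atTop]
    have hfin : {i | firstNew (t i) (t (i + 1)) ∉ Q₀ ∧ a (t i) ∈ S}.Finite := by
      refine Set.Finite.of_injOn (f := fun i => a (t i)) (t := (S : Set G)) (fun i hi => hi.2) ?_
        S.finite_toSet
      intro i hi j hj he
      rcases lt_trichotomy i j with h | h | h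
      · exact absurd he (hinj i j hi.1 h)
      · exact h
      · exact absurd he.symm (hinj j i hj.1 h)
    exact hfin.compl_mem_cofinite
  have hfreq : ∃ᶠ i in Filter.atTop, k (nodePoint (t i)) ∈ W₁ ∩ W₂ := by
    have hnb : {z : treeSpace WellOrderedSubsetRat × K | z.2 ∈ W₁ ∩ W₂} ∈ nhds (x₀, k₀) :=
      (continuous_snd.tendsto (x₀, k₀)) (Filter.inter_mem hW₁ hW₂)
    exact hcl.frequently hnb
  obtain ⟨m, hm, hmp⟩ := Filter.extraction_of_frequently_atTop
    (hfreq.and_eventually (hgood.and hnotS))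
  obtain ⟨M, hM⟩ : ∃ M, M = R₀.card + 1 := ⟨_, rfl⟩
  have hpt : ∀ j ∈ Finset.Icc 1 M, ∃ n ∈ R₀,
      Φ ((k (nodePoint (t (m 0))), k (nodePoint (t (m (M + 1))))),
        TopologicalSpace.denseSeq unitInterval n) ∈
        (φ (a (t (m j)))).upper \ (φ (a (t (m j)))).lower := by
    intro j hj
    rw [Finset.mem_Icc] at hj
    have e1 := hout (m j) (nodePoint (t (m 0))) ((nodePoint_apply _ _).2 (hs₀ _).le)
      (fun h => (ht (hm (show 0 < j by omega))).not_ge ((nodePoint_apply _ _).1 h))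
    have e2 := hin (m j) (m (M + 1)) (hmp j).2.1 (hm (by omega)) (nodePoint (t (m (M + 1))))
      ((nodePoint_apply _ _).2 le_rfl)
    have hR' := hR (t (m j))
    rw [(htS (m j)).2.1] at hR'
    refine hR' _ _ ?_
    have c1 := hk (nodePoint (t (m 0))) (a (t (m j)))
    have c2 := hk (nodePoint (t (m (M + 1)))) (a (t (m j)))
    have c3 := ha (t (m j))
    tauto
  have hfinal : ∀ i j, 1 ≤ i → i < j → j ≤ M → ∀ n ∈ R₀,
      Φ ((k (nodePoint (t (m 0))), k (nodePoint (t (m (M + 1))))),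
        TopologicalSpace.denseSeq unitInterval n) ∈
        (φ (a (t (m i)))).upper \ (φ (a (t (m i)))).lower →
      Φ ((k (nodePoint (t (m 0))), k (nodePoint (t (m (M + 1))))),
        TopologicalSpace.denseSeq unitInterval n) ∈
        (φ (a (t (m j)))).upper \ (φ (a (t (m j)))).lower → False := by
    intro i j hi hij hj n hn hyi hyj
    have hy := hW (Set.mk_mem_prod (hmp 0).1.1 (hmp (M + 1)).1.2) n hn
    have hne : a (t (m i)) ≠ a (t (m j)) := hinj _ _ (hmp i).2.1 (hm hij)
    have hiS : a (t (m i)) ∉ S := fun h => (hmp i).2.2 ⟨(hmp i).2.1, h⟩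
    have hjS : a (t (m j)) ∉ S := fun h => (hmp j).2.2 ⟨(hmp j).2.1, h⟩
    obtain ⟨x, hx⟩ := hφ.exists_mem_upper (insert (a (t (m i))) (insert (a (t (m j))) S))
      (fun b => if b = a (t (m i)) then preNodePoint (t (m i)) ∈ b.1 else
        if b = a (t (m j)) then nodePoint (t (m j)) ∈ b.1 else x₀ ∈ b.1) _ (by
        intro b hb
        by_cases hbi : b = a (t (m i))
        · subst hbi
          exact ⟨fun _ => hyi.1, fun _ => hyi.2⟩
        by_cases hbj : b = a (t (m j))
        · subst hbj
          exact ⟨fun _ => hyj.1, fun _ => hyj.2⟩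
        simp only [hbi, hbj, if_false]
        simp only [Finset.mem_insert, hbi, hbj, false_or] at hb
        exact hy b hb)
    have hxi := hx _ (Finset.mem_insert_self _ _)
    have hxj := hx _ (Finset.mem_insert_of_mem (Finset.mem_insert_self _ _))
    simp only [if_true, hne.symm, if_false] at hxi hxj
    have hxs : x.1 s₀ = true := hS x fun b hb => by
      have h := hx b (Finset.mem_insert_of_mem (Finset.mem_insert_of_mem hb))
      have hbi : b ≠ a (t (m i)) := fun e => hiS (e ▸ hb)
      have hbj : b ≠ a (t (m j)) := fun e => hjS (e ▸ hb)
      rwa [if_neg hbi, if_neg hbj] at h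
    have hxt : x.1 (t (m j)) = true := by
      by_contra h
      exact ha _ ((hout _ x hxs h).symm.trans hxj)
    exact ha _ (hxi.symm.trans (hin _ _ (hmp i).2.1 (hm hij) x hxt))
  choose! n hn hny using hpt
  obtain ⟨i, hi, j, hj, hij, he⟩ := Finset.exists_ne_map_eq_of_card_lt_of_maps_to
    (s := Finset.Icc 1 M) (t := R₀) (by rw [Nat.card_Icc]; omega) (f := n) hn
  rw [Finset.mem_Icc] at hi hj
  have hyi := hny i (Finset.mem_Icc.2 hi)
  have hyj := hny j (Finset.mem_Icc.2 hj)
  rcases lt_or_gt_of_ne hij with h | h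
  · exact hfinal i j hi.1 h hj.2 _ (hn j (Finset.mem_Icc.2 hj)) (he ▸ hyi) hyj
  · exact hfinal j i hj.1 h hi.2 _ (hn j (Finset.mem_Icc.2 hj)) hyj (he ▸ hyi)

theorem not_isBooleanImage_convex {E : Type v} [AddCommGroup E] [Module ℝ E] [TopologicalSpace E]
    [IsTopologicalAddGroup E] [ContinuousSMul ℝ E] [T2Space E] (K : Set E) [CompactSpace K]
    (hK : Convex ℝ K) : ¬ IsBooleanImage (treeSpace WellOrderedSubsetRat) K := by
  refine not_isBooleanImage_of_equiconnected
    (fun p => ⟨(1 - (p.2 : ℝ)) • (p.1.1 : E) + (p.2 : ℝ) • (p.1.2 : E),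
      hK p.1.1.2 p.1.2.2 (by linarith [p.2.2.2]) p.2.2.1 (by ring)⟩)
    (Continuous.subtype_mk (by fun_prop) _) (fun x y => ?_) (fun x y => ?_) fun x r => ?_
  · exact Subtype.ext (by simp)
  · exact Subtype.ext (by simp)
  · exact Subtype.ext (by simp [← add_smul])

end WellOrderedSubsetRat

theorem mainTheorem5 :
    (∃ (K : Type) (_ : TopologicalSpace K) (_ : CompactSpace K) (_ : T2Space K),
      PathConnectedSpace K ∧ IsBooleanImage (treeSpace WellOrderedSubsetRat) K) ∧
    (∀ (E : Type u) [AddCommGroup E] [Module ℝ E] [TopologicalSpace E]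
      [IsTopologicalAddGroup E] [ContinuousSMul ℝ E] [T2Space E]
      (K : Set E) [CompactSpace K], Convex ℝ K →
        ¬ IsBooleanImage (treeSpace WellOrderedSubsetRat) K) :=
  ⟨⟨filledTreeSpace WellOrderedSubsetRat, inferInstance, inferInstance, inferInstance,
    WellOrderedSubsetRat.pathConnectedSpace_filledTreeSpace, isBooleanImage_filledTreeSpace⟩,
    fun _ _ _ _ _ _ _ K _ hK => WellOrderedSubsetRat.not_isBooleanImage_convex K hK⟩
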